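/- Let $K$ be a field, $n\ge 0$ an integer, $S=K[x_1,\dots,x_n]$, and let $\Delta$ be a simplicial complex on $[n]=\{1,\dots,n\}$, i.e. a collection of subsets of $[n]$ closed under taking subsets (singletons need not belong to $\Delta$). Let $I_\Delta\subseteq S$ be its Stanley–Reisner ideal, generated by the monomials $x_N=\prod_{j\in N}x_j$ with $N\subseteq[n]$, $N\notin\Delta$. A monomial ideal $J\subseteq S[y]$ is a *separation* of an ideal $I\subseteq S$ for the variable $x_i$ if (i) $I$ is the image of $J$ under the $K$-algebra homomorphism $S[y]\to S$ with $y\mapsto x_i$ and $x_j\mapsto x_j$ for all $j$; (ii) $x_i$ divides some minimal monomial generator of $J$, and $y$ divides some minimal monomial generator of $J$; (iii) $y-x_i$ is a non-zerodivisor on $S[y]/J$. The complex $\Delta$ is *inseparable* if $I_\Delta$ admits no separation for any of the variables $x_1,\dots,x_n$. For $i\in[n]$ let $N_{\{i\}}(\Delta)=\{F\in\Delta : i\notin F,\ F\cup\{i\}\notin\Delta\}$, and let $G_{\{i\}}(\Delta)$ be the graph with vertex set $N_{\{i\}}(\Delta)$ in which $\{F,G\}$ is an edge if and only if $F\subsetneq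 G$ or $G\subsetneq F$. Let $T^1(\Delta)$ be the cokernel of the map $\operatorname{Der}_K(S)\to\operatorname{Hom}_S(I_\Delta,S/I_\Delta)$, $\partial\mapsto(f\mapsto \partial f+I_\Delta)$. It is $\mathbb Z^n$-graded; $T^1(\Delta)_c$ denotes its component of degree $c\in\mathbb Z^n$, consisting of the classes of the homogeneous homomorphisms $I_\Delta\to S/I_\Delta$ of degree $c$, and $e_i$ denotes the $i$-th canonical basis vector of $\mathbb Z^n$. Then the following conditions are equivalent: (a) $\Delta$ is inseparable; (b) $G_{\{i\}}(\Delta)$ is connected for $i=1,\dots,n$, where the graph without vertices counts as connected; (c) $T^1(\Delta)_{-e_i}=0$ for $i=1,\dots,n$. -/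

import Mathlib

open MvPolynomial

noncomputable section

/-- A simplicial complex on the vertex set `V`: a collection of finite subsets of `V` closed under
passing to subsets. The empty set may be a face, singletons need not be faces, and the empty
collection is allowed. -/
abbrev SimplicialCpx (V : Type*) := LowerSet (Finset V)

namespace SimplicialCpx

variable {V : Type*}

/-- The Stanley–Reisner ideal, generated by the monomials `x_N` with `N` a non-face. -/
def stanleyReisnerIdeal (K : Type*) [Field K] (Δ : SimplicialCpx V) : Ideal (MvPolynomial V K) :=
  Ideal.span {f | ∃ N : Finset V, N ∉ Δ ∧ f = ∏ j ∈ N, X j}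

/-- `N_B(Δ)`: the faces `F` disjoint from `B` such that `F ∪ B` is not a face. -/
def nonJoinable [DecidableEq V] (Δ : SimplicialCpx V) (B : Finset V) : Set (Finset V) :=
  {F | F ∈ Δ ∧ Disjoint F B ∧ F ∪ B ∉ Δ}

/-- The graph `G_B(Δ)` on `N_B(Δ)` whose edges are given by strict inclusion. -/
def inclusionGraph [DecidableEq V] (Δ : SimplicialCpx V) (B : Finset V) :
    SimpleGraph (Δ.nonJoinable B) where
  Adj F G := F.1 ⊂ G.1 ∨ G.1 ⊂ F.1
  symm := ⟨fun _ _ h => h.symm⟩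
  loopless := ⟨fun _ h => h.elim (fun h => (ssubset_irrefl _ h).elim)
    (fun h => (ssubset_irrefl _ h).elim)⟩

end SimplicialCpx

section Separation

variable {V K : Type*} [Field K]

/-- Ideals generated by monomials. -/
def IsMonomialIdeal (J : Ideal (MvPolynomial V K)) : Prop :=
  ∃ A : Set (V →₀ ℕ), J = Ideal.span ((fun a => monomial a (1 : K)) '' A)

/-- `x^a` is a minimal monomial generator of the monomial ideal `J`: it is a monomial of `J` that is
minimal with respect to divisibility. -/
def IsMinimalGenerator (J : Ideal (MvPolynomial V K)) (a : V →₀ ℕ) : Prop :=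
  Minimal (fun b => monomial b (1 : K) ∈ J) a

/-- The `K`-algebra homomorphism `S[y] → S`, `y ↦ x_i`, `x_j ↦ x_j`. The ring `S[y]` is the
polynomial ring on `Option V`, with `y = X none` and `x_j = X (some j)`. -/
def specializeY (i : V) : MvPolynomial (Option V) K →ₐ[K] MvPolynomial V K :=
  aeval (fun o => o.elim (X i) X)

/-- `J ⊆ S[y]` is a separation of `I ⊆ S` for the variable `x_i`. -/
structure IsSeparation (I : Ideal (MvPolynomial V K)) (i : V)
    (J : Ideal (MvPolynomial (Option V) K)) : Prop where
  isMonomialIdeal : IsMonomialIdeal J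
  image_eq : specializeY i '' (J : Set (MvPolynomial (Option V) K)) = I
  x_dvd : ∃ a, IsMinimalGenerator J a ∧
    (X (some i) : MvPolynomial (Option V) K) ∣ monomial a 1
  y_dvd : ∃ a, IsMinimalGenerator J a ∧
    (X none : MvPolynomial (Option V) K) ∣ monomial a 1
  nonZeroDivisor : Ideal.Quotient.mk J (X none - X (some i)) ∈
    nonZeroDivisors (MvPolynomial (Option V) K ⧸ J)

/-- `Δ` is inseparable (over `K`): its Stanley–Reisner ideal admits no separation for any
variable. -/
def SimplicialCpx.IsInseparable (K : Type*) [Field K] (Δ : SimplicialCpx V) : Prop :=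
  ¬ ∃ (i : V) (J : Ideal (MvPolynomial (Option V) K)),
    IsSeparation (Δ.stanleyReisnerIdeal K) i J

end Separation

section Cotangent

variable {V K : Type*} [Field K]

/-- The natural map `δ* : Der_K(S) → Hom_S(I, S/I)`, `∂ ↦ (f ↦ ∂f + I)`. -/
def deltaStar (I : Ideal (MvPolynomial V K)) :
    Derivation K (MvPolynomial V K) (MvPolynomial V K) →ₗ[MvPolynomial V K]
      (I →ₗ[MvPolynomial V K] MvPolynomial V K ⧸ I) where
  toFun D :=
    { toFun := fun f => Ideal.Quotient.mk I (D f)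
      map_add' := fun f g => by simp
      map_smul' := fun s f => by
        have h : (f : MvPolynomial V K) * D s ∈ I := I.mul_mem_right _ f.2
        simp only [SetLike.val_smul, smul_eq_mul, Derivation.leibniz, map_add, RingHom.id_apply]
        rw [Ideal.Quotient.eq_zero_iff_mem.mpr h, add_zero]
        rfl }
  map_add' D E := by ext f; simp
  map_smul' s D := by ext f; rfl

/-- The first cotangent module `T¹(S/I)`: the cokernel of `δ*`. -/
abbrev CotangentT1 (I : Ideal (MvPolynomial V K)) : Type _ :=
  (I →ₗ[MvPolynomial V K] MvPolynomial V K ⧸ I) ⧸ LinearMap.range (deltaStar I)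

/-- The component of `S/I` in degree `d ∈ ℤ^V`; it is zero if `d` has a negative entry. -/
def quotientComponent (I : Ideal (MvPolynomial V K)) (d : V → ℤ) :
    Submodule K (MvPolynomial V K ⧸ I) :=
  Submodule.span K {q | ∃ a : V →₀ ℕ, (∀ j, (a j : ℤ) = d j) ∧
    q = Ideal.Quotient.mk I (monomial a 1)}

/-- The homogeneous homomorphisms `I → S/I` of degree `c ∈ ℤ^V`: those that map `I_a` to
`(S/I)_{a+c}` for every `a`. -/
def homComponent (I : Ideal (MvPolynomial V K)) (c : V → ℤ) :
    Submodule K (I →ₗ[MvPolynomial V K] MvPolynomial V K ⧸ I) where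
  carrier := {φ | ∀ (a : V →₀ ℕ) (r : K) (h : monomial a r ∈ I),
    φ ⟨monomial a r, h⟩ ∈ quotientComponent I (fun j => (a j : ℤ) + c j)}
  add_mem' hφ hψ a r h := Submodule.add_mem _ (hφ a r h) (hψ a r h)
  zero_mem' _ _ _ := Submodule.zero_mem _
  smul_mem' k _ hφ a r h := Submodule.smul_mem _ k (hφ a r h)

/-- The component `T¹(S/I)_c` of degree `c ∈ ℤ^V` for a monomial ideal `I`: the classes of the
homogeneous homomorphisms of degree `c`. -/
def cotangentT1Component (I : Ideal (MvPolynomial V K)) (c : V → ℤ) :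
    Submodule K (CotangentT1 I) :=
  (homComponent I c).map ((LinearMap.range (deltaStar I)).mkQ.restrictScalars K)

end Cotangent

end

/-!
Conditions (a) and (c) are both statements about labellings `ℓ` of the faces `F ∈ N_{i}(Δ)` with
`ℓ(F) = ℓ(G)` whenever `F ⊆ G`, that is, about functions on the connected components of the graph
`G_{i}(Δ)`.

A homomorphism `φ : I_Δ → S/I_Δ` of degree `-e_i` kills every generator `x_N` except those with
`N = F ∪ {i}`, `F ∈ N_{i}(Δ)`, for which `φ(x_i x_F) = ℓ(F) x_F` with `ℓ(F) ∈ K`. If `F ⊆ G`, then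
multiplying by `x_{G ∖ F}` gives `ℓ(F) = ℓ(G)`. Conversely, weighting `∂/∂x_i` by such a labelling
defines a homomorphism, and `φ` comes from a derivation exactly when `ℓ` is constant.

For a separation `J` of `I_Δ` for `x_i`, each `x_i x_F` lifts to `ℓ(F) x_F ∈ J` with
`ℓ(F) ∈ {y, x_i}`. The label is unique, because `y x_F, x_i x_F ∈ J` would imply `x_F ∈ J` as
`y - x_i` is a non-zerodivisor modulo `J`. If the label is constant, the same argument shows that
the other variable divides no minimal generator. Conversely, a non-constant labelling by `y` and
`x_i` defines an ideal `J` by replacing `x_i` with `ℓ(F)` in each `x_i x_F`; it is again a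
Stanley–Reisner ideal, the intersection of the primes generated by the variables outside a face.
Every face of the new complex remains a face after adding `y` or `x_i`, and `y - x_i` does not lie
in the primes of these larger faces.
-/

section SquarefreeMonomial

variable {V : Type*}

/-- The exponent vector of the squarefree monomial `x_F = ∏ j ∈ F, x_j`. -/
noncomputable def squarefreeExponent (F : Finset V) : V →₀ ℕ :=
  ∑ j ∈ F, Finsupp.single j 1

lemma squarefreeExponent_apply [DecidableEq V] (F : Finset V) (j : V) :
    squarefreeExponent F j = if j ∈ F then 1 else 0 := by
  simp [squarefreeExponent, Finsupp.finsetSum_apply, Finsupp.single_apply]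

@[simp]
lemma support_squarefreeExponent (F : Finset V) : (squarefreeExponent F).support = F := by
  classical
  ext j
  simp [squarefreeExponent_apply]

lemma squarefreeExponent_le_iff {F : Finset V} {a : V →₀ ℕ} :
    squarefreeExponent F ≤ a ↔ F ⊆ a.support := by
  classical
  refine ⟨fun h => by simpa using Finsupp.support_mono h, fun h j => ?_⟩
  rw [squarefreeExponent_apply]
  split_ifs with hj
  · exact Nat.one_le_iff_ne_zero.mpr (Finsupp.mem_support_iff.mp (h hj))
  · exact Nat.zero_le _

lemma squarefreeExponent_mono {F G : Finset V} (h : F ⊆ G) :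
    squarefreeExponent F ≤ squarefreeExponent G := by
  rwa [squarefreeExponent_le_iff, support_squarefreeExponent]

lemma squarefreeExponent_insert [DecidableEq V] {F : Finset V} {j : V} (h : j ∉ F) :
    squarefreeExponent (insert j F) = squarefreeExponent F + Finsupp.single j 1 := by
  rw [squarefreeExponent, Finset.sum_insert h, add_comm, squarefreeExponent]

lemma squarefreeExponent_sdiff_add [DecidableEq V] {F G : Finset V} (h : F ⊆ G) :
    squarefreeExponent (G \ F) + squarefreeExponent F = squarefreeExponent G :=
  Finset.sum_sdiff h

lemma support_erase_subset_support_sub_single [DecidableEq V] (a : V →₀ ℕ) (i : V) :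
    a.support.erase i ⊆ (a - Finsupp.single i 1).support := by
  intro j hj
  obtain ⟨hji, hj⟩ := Finset.mem_erase.mp hj
  rwa [Finsupp.mem_support_iff, Finsupp.tsub_apply, Finsupp.single_eq_of_ne hji, tsub_zero,
    ← Finsupp.mem_support_iff]

lemma prod_X_eq_monomial {R : Type*} [CommSemiring R] (F : Finset V) :
    (∏ j ∈ F, X j : MvPolynomial V R) = monomial (squarefreeExponent F) 1 := by
  rw [squarefreeExponent, monomial_sum_one]
  rfl

end SquarefreeMonomial

section MonomialIdeal

variable {V : Type*}

lemma monomial_mem_of_le {R : Type*} [CommSemiring R] {J : Ideal (MvPolynomial V R)}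
    {a b : V →₀ ℕ} (hab : a ≤ b) (h : monomial a (1 : R) ∈ J) (r : R) : monomial b r ∈ J := by
  have := J.mul_mem_left (monomial (b - a) r) h
  rwa [monomial_mul, tsub_add_cancel_of_le hab, mul_one] at this

lemma X_dvd_monomial_one_iff {R : Type*} [CommSemiring R] [Nontrivial R] {v : V} {a : V →₀ ℕ} :
    (X v : MvPolynomial V R) ∣ monomial a 1 ↔ a v ≠ 0 := by
  simp [X_dvd_monomial]

variable {K : Type*} [Field K] {J : Ideal (MvPolynomial V K)}

lemma monomial_mem_span_monomial_iff {A : Set (V →₀ ℕ)} {a : V →₀ ℕ} :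
    monomial a (1 : K) ∈ Ideal.span ((fun b => monomial b (1 : K)) '' A) ↔ ∃ b ∈ A, b ≤ a := by
  classical
  rw [mem_ideal_span_monomial_image, support_monomial, if_neg one_ne_zero]
  simp

lemma IsMonomialIdeal.mem_iff (hJ : IsMonomialIdeal J) {f : MvPolynomial V K} :
    f ∈ J ↔ ∀ a ∈ f.support, monomial a (1 : K) ∈ J := by
  obtain ⟨A, rfl⟩ := hJ
  rw [mem_ideal_span_monomial_image]
  exact forall₂_congr fun a _ => monomial_mem_span_monomial_iff.symm

lemma IsMonomialIdeal.induction (hJ : IsMonomialIdeal J) {p : MvPolynomial V K → Prop}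
    (zero : p 0) (add : ∀ f g, p f → p g → p (f + g))
    (monomial : ∀ a r, monomial a (1 : K) ∈ J → p (monomial a r)) {f : MvPolynomial V K}
    (hf : f ∈ J) : p f := by
  rw [f.as_sum]
  exact Finset.sum_induction _ p add zero fun a ha => monomial a _ (hJ.mem_iff.mp hf a ha)

lemma exists_isMinimalGenerator_le {a : V →₀ ℕ} (ha : monomial a (1 : K) ∈ J) :
    ∃ b ≤ a, IsMinimalGenerator J b :=
  exists_minimal_le_of_wellFoundedLT (fun b => monomial b (1 : K) ∈ J) a ha

lemma mk_mem_nonZeroDivisors_iff {R : Type*} [CommRing R] {I : Ideal R} {x : R} :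
    Ideal.Quotient.mk I x ∈ nonZeroDivisors (R ⧸ I) ↔ ∀ f, x * f ∈ I → f ∈ I := by
  simp only [mem_nonZeroDivisors_iff_left, Ideal.Quotient.mk_surjective.forall, ← map_mul,
    Ideal.Quotient.eq_zero_iff_mem]

end MonomialIdeal

section RestrictVars

variable {V R : Type*} [CommSemiring R]

/-- The projection `R[x_V] → R[x_A]` that kills the variables outside `A`. Over a domain its kernel
is the prime ideal `(x_j : j ∉ A)`. -/
noncomputable def restrictVars (A : Finset V) : MvPolynomial V R →ₐ[R] MvPolynomial A R :=
  killCompl Subtype.val_injective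

lemma restrictVars_eq_zero_iff {A : Finset V} {f : MvPolynomial V R} :
    restrictVars A f = 0 ↔ ∀ a : V →₀ ℕ, a.support ⊆ A → coeff a f = 0 := by
  classical
  simp only [restrictVars, MvPolynomial.ext_iff, coeff_killCompl, coeff_zero]
  refine ⟨fun h a ha => ?_, fun h a => h _ ?_⟩
  · rw [← Finsupp.mapDomain_comapDomain _ Subtype.val_injective a fun j hj => ⟨⟨j, ha hj⟩, rfl⟩]
    exact h _
  · rw [Finsupp.mapDomain_support_of_injective Subtype.val_injective]
    simp [Finset.image_subset_iff]

lemma restrictVars_X_of_mem {A : Finset V} {v : V} (h : v ∈ A) :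
    restrictVars A (X v : MvPolynomial V R) = X ⟨v, h⟩ := by
  rw [← killCompl_rename_app (Subtype.val_injective (p := (· ∈ A))) (X (⟨v, h⟩ : A)), rename_X]
  rfl

lemma restrictVars_X_of_notMem {A : Finset V} {v : V} (h : v ∉ A) :
    restrictVars A (X v : MvPolynomial V R) = 0 :=
  killCompl_monomial_eq_zero_of_not_subset _ _ (by simp [h])

lemma restrictVars_eq_zero_of_subset {A B : Finset V} (hAB : A ⊆ B) {f : MvPolynomial V R}
    (hf : restrictVars B f = 0) : restrictVars A f = 0 := by
  rw [restrictVars_eq_zero_iff] at hf ⊢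
  exact fun a ha => hf a (ha.trans hAB)

lemma restrictVars_X_sub_X_ne_zero {R : Type*} [CommRing R] [Nontrivial R] {A : Finset V}
    {u v : V} (huv : u ≠ v) (h : u ∈ A ∨ v ∈ A) :
    restrictVars A (X u - X v : MvPolynomial V R) ≠ 0 := by
  by_cases hu : u ∈ A <;> by_cases hv : v ∈ A
  · simpa [restrictVars_X_of_mem, hu, hv, sub_eq_zero, X_inj] using huv
  · simp [restrictVars_X_of_mem hu, restrictVars_X_of_notMem hv]
  · simp [restrictVars_X_of_notMem hu, restrictVars_X_of_mem hv]
  · exact absurd h (by simp [hu, hv])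

end RestrictVars

namespace SimplicialCpx

section StanleyReisner

variable {V : Type*} (K : Type*) [Field K] (Δ : SimplicialCpx V)

lemma stanleyReisnerIdeal_eq_span : Δ.stanleyReisnerIdeal K =
    Ideal.span ((fun a => monomial a (1 : K)) '' (squarefreeExponent '' {N | N ∉ Δ})) := by
  simp only [stanleyReisnerIdeal, prod_X_eq_monomial, Set.image_image]
  congr 1
  ext f
  simp [eq_comm]

lemma isMonomialIdeal_stanleyReisnerIdeal : IsMonomialIdeal (Δ.stanleyReisnerIdeal K) :=
  ⟨_, Δ.stanleyReisnerIdeal_eq_span K⟩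

variable {K Δ}

lemma monomial_mem_stanleyReisnerIdeal_iff {a : V →₀ ℕ} :
    monomial a (1 : K) ∈ Δ.stanleyReisnerIdeal K ↔ a.support ∉ Δ := by
  simp only [stanleyReisnerIdeal_eq_span, monomial_mem_span_monomial_iff, Set.exists_mem_image,
    Set.mem_ofPred_eq, squarefreeExponent_le_iff]
  exact ⟨fun ⟨_, hN, hle⟩ ha => hN (Δ.lower hle ha), fun h => ⟨_, h, subset_rfl⟩⟩

lemma monomial_mem_stanleyReisnerIdeal {a : V →₀ ℕ} (ha : a.support ∉ Δ) (r : K) :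
    monomial a r ∈ Δ.stanleyReisnerIdeal K :=
  monomial_mem_of_le le_rfl (monomial_mem_stanleyReisnerIdeal_iff.mpr ha) r

lemma mem_stanleyReisnerIdeal_iff {f : MvPolynomial V K} :
    f ∈ Δ.stanleyReisnerIdeal K ↔ ∀ a : V →₀ ℕ, a.support ∈ Δ → coeff a f = 0 := by
  rw [(Δ.isMonomialIdeal_stanleyReisnerIdeal K).mem_iff]
  refine forall_congr' fun a => ?_
  rw [monomial_mem_stanleyReisnerIdeal_iff, mem_support_iff]
  exact not_imp_not

lemma mk_monomial_squarefreeExponent_injective {F : Finset V} (hF : F ∈ Δ) :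
    Function.Injective fun r : K =>
      Ideal.Quotient.mk (Δ.stanleyReisnerIdeal K) (monomial (squarefreeExponent F) r) := by
  classical
  intro r s h
  have := mem_stanleyReisnerIdeal_iff.mp (Ideal.Quotient.eq.mp h) (squarefreeExponent F) (by simpa)
  simpa [sub_eq_zero] using this

/-- This is the primary decomposition `I_Δ = ⋂ (x_j : j ∉ A)` over the faces `A`. -/
lemma mem_stanleyReisnerIdeal_iff_restrictVars {f : MvPolynomial V K} :
    f ∈ Δ.stanleyReisnerIdeal K ↔ ∀ A ∈ Δ, restrictVars A f = 0 := by
  simp only [restrictVars_eq_zero_iff]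
  rw [mem_stanleyReisnerIdeal_iff]
  exact ⟨fun h A hA a ha => h a (Δ.lower ha hA), fun h a ha => h _ ha a subset_rfl⟩

variable [DecidableEq V]

lemma mk_X_sub_X_mem_nonZeroDivisors {u v : V} (huv : u ≠ v)
    (h : ∀ A ∈ Δ, insert u A ∈ Δ ∨ insert v A ∈ Δ) :
    Ideal.Quotient.mk (Δ.stanleyReisnerIdeal K) (X u - X v) ∈
      nonZeroDivisors (MvPolynomial V K ⧸ Δ.stanleyReisnerIdeal K) := by
  refine mk_mem_nonZeroDivisors_iff.mpr fun f hf => ?_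
  rw [mem_stanleyReisnerIdeal_iff_restrictVars] at hf ⊢
  have vanish : ∀ A ∈ Δ, u ∈ A ∨ v ∈ A → restrictVars A f = 0 := fun A hA hmem =>
    (mul_eq_zero.mp (by rw [← map_mul, hf A hA])).resolve_left
      (restrictVars_X_sub_X_ne_zero huv hmem)
  intro A hA
  rcases h A hA with h | h
  · exact restrictVars_eq_zero_of_subset (Finset.subset_insert u A) (vanish _ h (by simp))
  · exact restrictVars_eq_zero_of_subset (Finset.subset_insert v A) (vanish _ h (by simp))

lemma exists_isMinimalGenerator_dvd {A : Finset V} {v : V} (hA : A ∈ Δ) (hvA : insert v A ∉ Δ) :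
    ∃ a, IsMinimalGenerator (Δ.stanleyReisnerIdeal K) a ∧
      (X v : MvPolynomial V K) ∣ monomial a 1 := by
  obtain ⟨a, hle, hmin⟩ := exists_isMinimalGenerator_le (K := K)
    (monomial_mem_stanleyReisnerIdeal (a := squarefreeExponent (insert v A)) (by simpa) 1)
  refine ⟨a, hmin, X_dvd_monomial_one_iff.mpr fun hv => ?_⟩
  have ha : a.support ⊆ A := fun j hj => by
    have := Finsupp.support_mono hle hj
    rw [support_squarefreeExponent, Finset.mem_insert] at this
    exact this.resolve_left fun hjv => Finsupp.mem_support_iff.mp hj (hjv ▸ hv)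
  exact monomial_mem_stanleyReisnerIdeal_iff.mp hmin.prop (Δ.lower ha hA)

end StanleyReisner

section InclusionGraph

variable {V : Type*} [DecidableEq V] {Δ : SimplicialCpx V}

lemma mem_nonJoinable_singleton {i : V} {F : Finset V} :
    F ∈ Δ.nonJoinable {i} ↔ F ∈ Δ ∧ i ∉ F ∧ insert i F ∉ Δ := by
  rw [nonJoinable, Set.mem_ofPred_eq, Finset.disjoint_singleton_right, Finset.union_comm,
    ← Finset.insert_eq]

variable {α : Type*} {B : Finset V}

/-- A labelling of finite sets whose restriction to the graph `G_B(Δ)` is constant on the edges,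
hence on the connected components. The labels of sets outside `N_B(Δ)` are irrelevant. -/
def IsComponentLabelling (Δ : SimplicialCpx V) (B : Finset V) (ℓ : Finset V → α) : Prop :=
  ∀ ⦃F G⦄, F ∈ Δ.nonJoinable B → G ∈ Δ.nonJoinable B → F ⊆ G → ℓ F = ℓ G

lemma IsComponentLabelling.eq_of_preconnected {ℓ : Finset V → α} (hℓ : Δ.IsComponentLabelling B ℓ)
    (h : (Δ.inclusionGraph B).Preconnected) {F G : Finset V} (hF : F ∈ Δ.nonJoinable B)
    (hG : G ∈ Δ.nonJoinable B) : ℓ F = ℓ G := by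
  have hwalk : ∀ {u v}, (Δ.inclusionGraph B).Walk u v → ℓ u = ℓ v := fun {u v} w => by
    induction w with
    | nil => rfl
    | @cons u v _ hadj _ ih =>
      refine Eq.trans ?_ ih
      exact hadj.elim (fun h => hℓ u.2 v.2 h.subset) fun h => (hℓ v.2 u.2 h.subset).symm
  exact (h ⟨F, hF⟩ ⟨G, hG⟩).elim hwalk

lemma exists_isComponentLabelling_of_not_preconnected (h : ¬ (Δ.inclusionGraph B).Preconnected)
    (x y : α) : ∃ ℓ : Finset V → α, Δ.IsComponentLabelling B ℓ ∧
      (∃ F ∈ Δ.nonJoinable B, ℓ F = x) ∧ (∃ G ∈ Δ.nonJoinable B, ℓ G = y) ∧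
      ∀ F, ℓ F = x ∨ ℓ F = y := by
  classical
  simp only [SimpleGraph.Preconnected, not_forall] at h
  obtain ⟨u, v, huv⟩ := h
  let C : Set (Finset V) := {F | ∃ hF, (Δ.inclusionGraph B).Reachable u ⟨F, hF⟩}
  have hC : ∀ ⦃F G⦄, F ∈ Δ.nonJoinable B → G ∈ Δ.nonJoinable B → F ⊆ G → (F ∈ C ↔ G ∈ C) := by
    intro F G hF hG hFG
    obtain rfl | hss := hFG.eq_or_ssubset
    · rfl
    have hadj : (Δ.inclusionGraph B).Adj ⟨F, hF⟩ ⟨G, hG⟩ := .inl hss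
    exact ⟨fun ⟨_, hr⟩ => ⟨hG, hr.trans hadj.reachable⟩,
      fun ⟨_, hr⟩ => ⟨hF, hr.trans hadj.symm.reachable⟩⟩
  refine ⟨fun F => if F ∈ C then x else y, fun F G hF hG hFG => by simp only [hC hF hG hFG],
    ⟨u, u.2, if_pos ⟨u.2, .rfl⟩⟩, ⟨v, v.2, if_neg fun hv => huv hv.2⟩, fun F => ite_eq_or_eq _ _ _⟩

end InclusionGraph

end SimplicialCpx

section CotangentModule

variable {V K : Type*} [Field K] {I : Ideal (MvPolynomial V K)}

lemma cotangentT1Component_eq_bot_iff {c : V → ℤ} :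
    cotangentT1Component I c = ⊥ ↔
      ∀ φ ∈ homComponent I c, φ ∈ LinearMap.range (deltaStar I) := by
  rw [cotangentT1Component, eq_bot_iff, Submodule.map_le_iff_le_comap]
  refine forall₂_congr fun φ _ => ?_
  rw [Submodule.mem_comap, Submodule.mem_bot, LinearMap.restrictScalars_apply,
    Submodule.mkQ_apply, Submodule.Quotient.mk_eq_zero]

lemma quotientComponent_eq_span_singleton {d : V → ℤ} {a : V →₀ ℕ} (h : ∀ j, (a j : ℤ) = d j) :
    quotientComponent I d = Submodule.span K {Ideal.Quotient.mk I (monomial a 1)} := by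
  rw [quotientComponent]
  congr 1
  ext q
  refine ⟨fun ⟨b, hb, hq⟩ => ?_, fun hq => ⟨a, h, hq⟩⟩
  rwa [show b = a from Finsupp.ext fun j => by exact_mod_cast (hb j).trans (h j).symm] at hq

lemma mem_quotientComponent_iff {d : V → ℤ} {a : V →₀ ℕ} (h : ∀ j, (a j : ℤ) = d j)
    {q : MvPolynomial V K ⧸ I} :
    q ∈ quotientComponent I d ↔ ∃ r : K, Ideal.Quotient.mk I (monomial a r) = q := by
  rw [quotientComponent_eq_span_singleton h, Submodule.mem_span_singleton]
  refine exists_congr fun r => ?_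
  rw [← mul_one r, ← smul_eq_mul, ← smul_monomial, smul_eq_mul, mul_one]
  rfl

lemma quotientComponent_eq_bot {d : V → ℤ}
    (h : ∀ a : V →₀ ℕ, (∀ j, (a j : ℤ) = d j) → monomial a (1 : K) ∈ I) :
    quotientComponent I d = ⊥ := by
  rw [quotientComponent, Submodule.span_eq_bot]
  rintro _ ⟨a, ha, rfl⟩
  exact Ideal.Quotient.eq_zero_iff_mem.mpr (h a ha)

variable [DecidableEq V]

lemma coe_sub_single_apply {a : V →₀ ℕ} {i : V} (hi : a i ≠ 0) (j : V) :
    ((a - Finsupp.single i 1 : V →₀ ℕ) j : ℤ) = a j + (-Pi.single i 1 : V → ℤ) j := by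
  obtain rfl | hij := eq_or_ne i j
  · rw [Finsupp.tsub_apply, Finsupp.single_eq_same, Pi.neg_apply, Pi.single_eq_same]
    omega
  · simp [hij.symm]

lemma mk_pderiv_monomial_mem_quotientComponent (i : V) (a : V →₀ ℕ) (r : K) :
    Ideal.Quotient.mk I (pderiv i (monomial a r)) ∈
      quotientComponent I (fun j => (a j : ℤ) + (-Pi.single i 1 : V → ℤ) j) := by
  rw [pderiv_monomial]
  obtain hi | hi := eq_or_ne (a i) 0
  · simp [hi]
  · exact (mem_quotientComponent_iff (coe_sub_single_apply hi)).mpr ⟨_, rfl⟩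

lemma deltaStar_pderiv_mem_homComponent (i : V) :
    deltaStar I (pderiv i) ∈ homComponent I (-Pi.single i 1 : V → ℤ) :=
  fun a r _ => mk_pderiv_monomial_mem_quotientComponent i a r

end CotangentModule

section Derivative

variable {V R : Type*} [CommSemiring R] [DecidableEq V] {i : V} {F : Finset V}

lemma pderiv_squarefree_insert (hi : i ∉ F) :
    pderiv i (monomial (squarefreeExponent (insert i F)) (1 : R)) =
      monomial (squarefreeExponent F) 1 := by
  rw [pderiv_monomial, squarefreeExponent_insert hi, add_tsub_cancel_right]
  simp [squarefreeExponent_apply, hi]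

lemma coeff_derivation_squarefree_insert
    (D : Derivation R (MvPolynomial V R) (MvPolynomial V R)) (hi : i ∉ F) :
    coeff (squarefreeExponent F) (D (monomial (squarefreeExponent (insert i F)) 1)) =
      coeff 0 (D (X i)) := by
  have hX : (monomial (squarefreeExponent (insert i F)) 1 : MvPolynomial V R) =
      monomial (squarefreeExponent F) 1 * X i := by
    rw [X, monomial_mul, squarefreeExponent_insert hi, one_mul]
  rw [hX, Derivation.leibniz, coeff_add, smul_eq_mul, smul_eq_mul, coeff_X_mul',
    if_neg (by simpa using hi), add_zero]
  simpa using coeff_monomial_mul 0 (squarefreeExponent F) (1 : R) (D (X i))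

/-- The `i`-th partial derivative with the derivative of `x^a` weighted by the label of
`supp a \ {i}`. -/
noncomputable def weightedPDeriv (i : V) (ℓ : Finset V → R) :
    MvPolynomial V R →ₗ[R] MvPolynomial V R :=
  (basisMonomials V R).constr R fun a => ℓ (a.support.erase i) • pderiv i (monomial a 1)

lemma weightedPDeriv_monomial (i : V) (ℓ : Finset V → R) (a : V →₀ ℕ) (r : R) :
    weightedPDeriv i ℓ (monomial a r) = ℓ (a.support.erase i) • pderiv i (monomial a r) := by
  have h : (monomial a r : MvPolynomial V R) = r • basisMonomials V R a := by
    simp [smul_monomial]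
  rw [h, map_smul, Derivation.map_smul, weightedPDeriv, Module.Basis.constr_basis, smul_comm,
    coe_basisMonomials]

end Derivative

namespace SimplicialCpx

section Cotangent

variable {V K : Type*} [Field K] [DecidableEq V] {Δ : SimplicialCpx V} {i : V}

lemma erase_mem_nonJoinable {N : Finset V} (hN : N ∉ Δ) (h : N.erase i ∈ Δ) :
    i ∈ N ∧ N.erase i ∈ Δ.nonJoinable {i} := by
  have hi : i ∈ N := by_contra fun hi => hN (Finset.erase_eq_of_notMem hi ▸ h)
  exact ⟨hi, mem_nonJoinable_singleton.mpr
    ⟨h, Finset.notMem_erase i N, by rwa [Finset.insert_erase hi]⟩⟩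

lemma monomial_insert_mem_stanleyReisnerIdeal {F : Finset V} (hF : F ∈ Δ.nonJoinable {i}) :
    monomial (squarefreeExponent (insert i F)) (1 : K) ∈ Δ.stanleyReisnerIdeal K :=
  monomial_mem_stanleyReisnerIdeal
    (by simpa using (mem_nonJoinable_singleton.mp hF).2.2) 1

lemma pderiv_monomial_mem_stanleyReisnerIdeal {a : V →₀ ℕ} (ha : a.support.erase i ∉ Δ) (r : K) :
    pderiv i (monomial a r) ∈ Δ.stanleyReisnerIdeal K := by
  rw [pderiv_monomial]
  exact monomial_mem_stanleyReisnerIdeal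
    (fun h => ha (Δ.lower (support_erase_subset_support_sub_single a i) h)) _

/-- A homomorphism of degree `-e_i` maps `x_N` to a multiple of `x_N / x_i`, which lies in the
ideal unless `N = F ∪ {i}` with `F ∈ N_{i}(Δ)`. -/
lemma linearMap_ext_of_mem_homComponent
    {φ ψ : Δ.stanleyReisnerIdeal K →ₗ[MvPolynomial V K]
      MvPolynomial V K ⧸ Δ.stanleyReisnerIdeal K}
    (hφ : φ ∈ homComponent (Δ.stanleyReisnerIdeal K) (-Pi.single i 1 : V → ℤ))
    (hψ : ψ ∈ homComponent (Δ.stanleyReisnerIdeal K) (-Pi.single i 1 : V → ℤ))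
    (h : ∀ F (hF : F ∈ Δ.nonJoinable {i}),
      φ ⟨_, monomial_insert_mem_stanleyReisnerIdeal hF⟩ =
        ψ ⟨_, monomial_insert_mem_stanleyReisnerIdeal hF⟩) : φ = ψ := by
  rw [Submodule.linearMap_eq_iff_of_eq_span φ ψ (Δ.stanleyReisnerIdeal_eq_span K)]
  rintro ⟨_, _, ⟨N, hN, rfl⟩, rfl⟩
  by_cases hNi : N.erase i ∈ Δ
  · obtain ⟨hi, hmem⟩ := erase_mem_nonJoinable hN hNi
    simpa only [Finset.insert_erase hi] using h _ hmem
  · have hbot : quotientComponent (Δ.stanleyReisnerIdeal K)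
        (fun j => (squarefreeExponent N j : ℤ) + (-Pi.single i 1 : V → ℤ) j) = ⊥ := by
      refine quotientComponent_eq_bot fun a ha =>
        monomial_mem_stanleyReisnerIdeal (fun hmem => hNi (Δ.lower (fun j hj => ?_) hmem)) 1
      obtain ⟨hji, hj⟩ := Finset.mem_erase.mp hj
      have haj : a j = 1 := by
        simpa [squarefreeExponent_apply, hj, hji] using ha j
      exact Finsupp.mem_support_iff.mpr (by omega)
    have hzero : ∀ χ ∈ homComponent (Δ.stanleyReisnerIdeal K) (-Pi.single i 1 : V → ℤ), ∀ h,
        χ ⟨monomial (squarefreeExponent N) 1, h⟩ = 0 := fun χ hχ h =>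
      (Submodule.mem_bot K).mp (hbot ▸ hχ _ _ h)
    exact (hzero φ hφ _).trans (hzero ψ hψ _).symm

lemma IsComponentLabelling.weightedPDeriv_monomial_mul_sub_mem {ℓ : Finset V → K}
    (hℓ : Δ.IsComponentLabelling {i} ℓ) (b : V →₀ ℕ) (s : K) {a : V →₀ ℕ} (ha : a.support ∉ Δ)
    (r : K) :
    weightedPDeriv i ℓ (monomial b s * monomial a r) -
      monomial b s * weightedPDeriv i ℓ (monomial a r) ∈ Δ.stanleyReisnerIdeal K := by
  set f : MvPolynomial V K := monomial b s
  set g : MvPolynomial V K := monomial a r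
  have hg : g ∈ Δ.stanleyReisnerIdeal K := monomial_mem_stanleyReisnerIdeal ha r
  have leibniz : pderiv i (f * g) = f * pderiv i g + g * pderiv i f := by
    rw [Derivation.leibniz, smul_eq_mul, smul_eq_mul]
  have hgf : g * pderiv i f ∈ Δ.stanleyReisnerIdeal K := Ideal.mul_mem_right _ _ hg
  have hT : weightedPDeriv i ℓ (f * g) = ℓ ((b + a).support.erase i) • pderiv i (f * g) := by
    rw [monomial_mul, weightedPDeriv_monomial]
  rw [hT, weightedPDeriv_monomial, mul_smul_comm]
  have hsub : a.support ⊆ (b + a).support := Finsupp.support_mono le_add_self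
  by_cases hmem : (b + a).support.erase i ∈ Δ
  · have hG := (erase_mem_nonJoinable (fun h => ha (Δ.lower hsub h)) hmem).2
    have hF := (erase_mem_nonJoinable ha (Δ.lower (Finset.erase_subset_erase i hsub) hmem)).2
    rw [← hℓ hF hG (Finset.erase_subset_erase i hsub), ← smul_sub, leibniz, add_sub_cancel_left]
    exact Submodule.smul_of_tower_mem _ _ hgf
  · have hfg : pderiv i (f * g) ∈ Δ.stanleyReisnerIdeal K := by
      rw [monomial_mul]
      exact pderiv_monomial_mem_stanleyReisnerIdeal hmem _
    refine sub_mem (Submodule.smul_of_tower_mem _ _ hfg) (Submodule.smul_of_tower_mem _ _ ?_)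
    rwa [leibniz, add_mem_cancel_right hgf] at hfg

lemma IsComponentLabelling.weightedPDeriv_mul_sub_mem {ℓ : Finset V → K}
    (hℓ : Δ.IsComponentLabelling {i} ℓ) (f : MvPolynomial V K) {g : MvPolynomial V K}
    (hg : g ∈ Δ.stanleyReisnerIdeal K) :
    weightedPDeriv i ℓ (f * g) - f * weightedPDeriv i ℓ g ∈ Δ.stanleyReisnerIdeal K := by
  refine (Δ.isMonomialIdeal_stanleyReisnerIdeal K).induction
    (p := fun g => weightedPDeriv i ℓ (f * g) - f * weightedPDeriv i ℓ g ∈ _) (by simp)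
    (fun g h hg hh => ?_) (fun a r ha => ?_) hg
  · simpa only [mul_add, map_add, add_sub_add_comm] using add_mem hg hh
  · induction f using MvPolynomial.induction_on' with
    | monomial b s =>
      exact hℓ.weightedPDeriv_monomial_mul_sub_mem b s
        (monomial_mem_stanleyReisnerIdeal_iff.mp ha) r
    | add p q hp hq => simpa only [add_mul, map_add, add_sub_add_comm] using add_mem hp hq

/-- The homomorphism `I_Δ → S/I_Δ` of degree `-e_i` that maps `x_{F ∪ {i}}` to `ℓ(F) x_F` for
`F ∈ N_{i}(Δ)`, induced by the weighted partial derivative. -/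
noncomputable def IsComponentLabelling.toLinearMap {ℓ : Finset V → K}
    (hℓ : Δ.IsComponentLabelling {i} ℓ) :
    Δ.stanleyReisnerIdeal K →ₗ[MvPolynomial V K] MvPolynomial V K ⧸ Δ.stanleyReisnerIdeal K where
  toFun g := Ideal.Quotient.mk _ (weightedPDeriv i ℓ g)
  map_add' g h := by simp
  map_smul' f g := Ideal.Quotient.eq.mpr (hℓ.weightedPDeriv_mul_sub_mem f g.2)

lemma IsComponentLabelling.toLinearMap_mem_homComponent {ℓ : Finset V → K}
    (hℓ : Δ.IsComponentLabelling {i} ℓ) :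
    hℓ.toLinearMap ∈ homComponent (Δ.stanleyReisnerIdeal K) (-Pi.single i 1 : V → ℤ) := by
  intro a r _
  change Ideal.Quotient.mk _ (weightedPDeriv i ℓ (monomial a r)) ∈ _
  rw [weightedPDeriv_monomial]
  exact Submodule.smul_mem _ _ (mk_pderiv_monomial_mem_quotientComponent i a r)

lemma IsComponentLabelling.eq_coeff_of_toLinearMap_eq_deltaStar {ℓ : Finset V → K}
    (hℓ : Δ.IsComponentLabelling {i} ℓ)
    {D : Derivation K (MvPolynomial V K) (MvPolynomial V K)}
    (h : deltaStar (Δ.stanleyReisnerIdeal K) D = hℓ.toLinearMap) {F : Finset V}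
    (hF : F ∈ Δ.nonJoinable {i}) : ℓ F = coeff 0 (D (X i)) := by
  obtain ⟨hFΔ, hi, -⟩ := mem_nonJoinable_singleton.mp hF
  have hmem : D (monomial (squarefreeExponent (insert i F)) 1) -
      ℓ F • monomial (squarefreeExponent F) 1 ∈ Δ.stanleyReisnerIdeal K := by
    have := LinearMap.congr_fun h ⟨_, monomial_insert_mem_stanleyReisnerIdeal hF⟩
    have hval := weightedPDeriv_monomial i ℓ (squarefreeExponent (insert i F)) (1 : K)
    rw [pderiv_squarefree_insert hi, support_squarefreeExponent, Finset.erase_insert hi] at hval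
    rw [← hval]
    exact Ideal.Quotient.eq.mp this
  have hcoeff := mem_stanleyReisnerIdeal_iff.mp hmem (squarefreeExponent F) (by simpa)
  rw [coeff_sub, coeff_derivation_squarefree_insert D hi, coeff_smul, coeff_monomial, if_pos rfl,
    smul_eq_mul, mul_one, sub_eq_zero] at hcoeff
  exact hcoeff.symm

lemma exists_apply_eq_mk_of_mem_homComponent
    {φ : Δ.stanleyReisnerIdeal K →ₗ[MvPolynomial V K] MvPolynomial V K ⧸ Δ.stanleyReisnerIdeal K}
    (hφ : φ ∈ homComponent (Δ.stanleyReisnerIdeal K) (-Pi.single i 1 : V → ℤ)) {F : Finset V}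
    (hF : F ∈ Δ.nonJoinable {i}) :
    ∃ r : K, ∀ h, φ ⟨monomial (squarefreeExponent (insert i F)) 1, h⟩ =
      Ideal.Quotient.mk _ (monomial (squarefreeExponent F) r) := by
  have hd : ∀ j, (squarefreeExponent F j : ℤ) =
      squarefreeExponent (insert i F) j + (-Pi.single i 1 : V → ℤ) j := fun j => by
    rw [← coe_sub_single_apply (by simp [squarefreeExponent_apply]),
      squarefreeExponent_insert (mem_nonJoinable_singleton.mp hF).2.1, add_tsub_cancel_right]
  obtain ⟨r, hr⟩ := (mem_quotientComponent_iff hd).mp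
    (hφ _ _ (monomial_insert_mem_stanleyReisnerIdeal hF))
  exact ⟨r, fun _ => hr.symm⟩

lemma exists_isComponentLabelling_of_mem_homComponent
    {φ : Δ.stanleyReisnerIdeal K →ₗ[MvPolynomial V K] MvPolynomial V K ⧸ Δ.stanleyReisnerIdeal K}
    (hφ : φ ∈ homComponent (Δ.stanleyReisnerIdeal K) (-Pi.single i 1 : V → ℤ)) :
    ∃ ℓ : Finset V → K, Δ.IsComponentLabelling {i} ℓ ∧ ∀ F ∈ Δ.nonJoinable {i},
      ∀ h, φ ⟨monomial (squarefreeExponent (insert i F)) 1, h⟩ =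
        Ideal.Quotient.mk _ (monomial (squarefreeExponent F) (ℓ F)) := by
  have hex := fun F (hF : F ∈ Δ.nonJoinable {i}) => exists_apply_eq_mk_of_mem_homComponent hφ hF
  choose! ℓ hℓ using hex
  refine ⟨ℓ, fun F G hF hG hFG => mk_monomial_squarefreeExponent_injective (K := K) hG.1 ?_, hℓ⟩
  have hxF := monomial_insert_mem_stanleyReisnerIdeal (K := K) hF
  have hxG : monomial (squarefreeExponent (G \ F)) 1 *
      monomial (squarefreeExponent (insert i F)) 1 =
        (monomial (squarefreeExponent (insert i G)) 1 : MvPolynomial V K) := by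
    rw [monomial_mul, mul_one, squarefreeExponent_insert (mem_nonJoinable_singleton.mp hF).2.1,
      squarefreeExponent_insert (mem_nonJoinable_singleton.mp hG).2.1, ← add_assoc,
      squarefreeExponent_sdiff_add hFG]
  calc Ideal.Quotient.mk (Δ.stanleyReisnerIdeal K) (monomial (squarefreeExponent G) (ℓ F))
      = Ideal.Quotient.mk _ (monomial (squarefreeExponent (G \ F)) 1) *
          Ideal.Quotient.mk _ (monomial (squarefreeExponent F) (ℓ F)) := by
        rw [← map_mul, monomial_mul, one_mul, squarefreeExponent_sdiff_add hFG]
    _ = φ (monomial (squarefreeExponent (G \ F)) (1 : K) • ⟨_, hxF⟩) := by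
        rw [map_smul, hℓ F hF]
        rfl
    _ = Ideal.Quotient.mk _ (monomial (squarefreeExponent G) (ℓ G)) := by
        rw [← hℓ G hG (monomial_insert_mem_stanleyReisnerIdeal hG)]
        exact congrArg φ (Subtype.ext hxG)

theorem cotangentT1Component_neg_single_eq_bot_iff :
    cotangentT1Component (Δ.stanleyReisnerIdeal K) (-Pi.single i 1 : V → ℤ) = ⊥ ↔
      (Δ.inclusionGraph {i}).Preconnected := by
  rw [cotangentT1Component_eq_bot_iff]
  constructor
  · intro h
    by_contra hconn
    obtain ⟨ℓ, hℓ, ⟨F, hF, hF1⟩, ⟨G, hG, hG0⟩, -⟩ :=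
      exists_isComponentLabelling_of_not_preconnected hconn (1 : K) 0
    obtain ⟨D, hD⟩ := h _ hℓ.toLinearMap_mem_homComponent
    have hFG : ℓ F = ℓ G := (hℓ.eq_coeff_of_toLinearMap_eq_deltaStar hD hF).trans
      (hℓ.eq_coeff_of_toLinearMap_eq_deltaStar hD hG).symm
    exact one_ne_zero (hF1.symm.trans (hFG.trans hG0))
  · intro hconn φ hφ
    obtain ⟨ℓ, hℓ, hφℓ⟩ := exists_isComponentLabelling_of_mem_homComponent hφ
    obtain ⟨c, hc⟩ : ∃ c, ∀ F ∈ Δ.nonJoinable {i}, ℓ F = c := by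
      by_cases hne : (Δ.nonJoinable {i}).Nonempty
      · exact ⟨_, fun F hF => hℓ.eq_of_preconnected hconn hF hne.some_mem⟩
      · exact ⟨0, fun F hF => absurd ⟨F, hF⟩ hne⟩
    have hmem := Submodule.smul_mem _ c
      (deltaStar_pderiv_mem_homComponent (I := Δ.stanleyReisnerIdeal K) i)
    rw [linearMap_ext_of_mem_homComponent hφ hmem fun F hF => ?_]
    · exact Submodule.smul_of_tower_mem _ c (LinearMap.mem_range_self _ (pderiv i))
    · rw [hφℓ F hF _, hc F hF]
      change _ = Ideal.Quotient.mk _ (c • pderiv i (monomial _ 1))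
      rw [pderiv_squarefree_insert (mem_nonJoinable_singleton.mp hF).2.1, smul_monomial,
        smul_eq_mul, mul_one]

end Cotangent

end SimplicialCpx

section Specialize

variable {V : Type*} {i : V}

/-- The exponent of the image of `x^a` under `S[y] → S`, `y ↦ x_i`. -/
noncomputable def specializeExponent (i : V) (a : Option V →₀ ℕ) : V →₀ ℕ :=
  a.mapDomain (·.getD i)

lemma support_specializeExponent [DecidableEq V] (a : Option V →₀ ℕ) :
    (specializeExponent i a).support = a.support.image (·.getD i) :=
  Finsupp.mapDomain_support_of_subsingletonAddUnits _ a

lemma specializeExponent_apply [DecidableEq V] (a : Option V →₀ ℕ) (j : V) :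
    specializeExponent i a j = a (some j) + if j = i then a none else 0 := by
  induction a using Finsupp.induction_linear with
  | zero => simp [specializeExponent]
  | add a b ha hb =>
    simp only [specializeExponent, Finsupp.mapDomain_add, Finsupp.add_apply] at ha hb ⊢
    rw [ha, hb]
    split_ifs <;> ring
  | single o n =>
    cases o <;> simp [specializeExponent, Finsupp.single_apply, eq_comm]

lemma specializeExponent_squarefree_map_some (F : Finset V) :
    specializeExponent i (squarefreeExponent (F.map .some)) = squarefreeExponent F := by
  simp [specializeExponent, squarefreeExponent, Finsupp.mapDomain_finsetSum]

lemma image_getD_map_some [DecidableEq V] (F : Finset V) :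
    (F.map .some).image (·.getD i) = F := by
  simp [Finset.map_eq_image, Finset.image_image, Function.comp_def]

lemma notMem_map_some {F : Finset V} (hi : i ∉ F) {u : Option V} (hu : u.getD i = i) :
    u ∉ F.map .some := by
  cases u <;> simp_all

variable {K : Type*} [Field K]

lemma specializeY_eq_rename :
    (specializeY i : MvPolynomial (Option V) K →ₐ[K] MvPolynomial V K) = rename (·.getD i) :=
  algHom_ext fun o => by cases o <;> simp [specializeY]

lemma specializeY_surjective : Function.Surjective
    (specializeY i : MvPolynomial (Option V) K →ₐ[K] MvPolynomial V K) := by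
  rw [specializeY_eq_rename]
  exact rename_surjective _ fun j => ⟨some j, rfl⟩

lemma specializeY_monomial (a : Option V →₀ ℕ) (r : K) :
    specializeY i (monomial a r) = monomial (specializeExponent i a) r := by
  rw [specializeY_eq_rename, rename_monomial, specializeExponent]

lemma eq_squarefree_map_some_of_specializeExponent_eq {F : Finset V} (hi : i ∉ F)
    {a : Option V →₀ ℕ} (h : specializeExponent i a = squarefreeExponent F) :
    a = squarefreeExponent (F.map .some) := by
  classical
  have hj := fun j => DFunLike.congr_fun h j
  simp only [specializeExponent_apply, squarefreeExponent_apply] at hj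
  ext (_ | j)
  · have := hj i
    simp_all [squarefreeExponent_apply]
  · have := hj j
    by_cases hji : j = i <;> simp_all [squarefreeExponent_apply]

variable [DecidableEq V]

lemma exists_eq_squarefree_insert_of_specializeExponent_eq {F : Finset V} (hi : i ∉ F)
    {a : Option V →₀ ℕ} (h : specializeExponent i a = squarefreeExponent (insert i F)) :
    ∃ u : Option V, u.getD i = i ∧ a = squarefreeExponent (insert u (F.map .some)) := by
  have hai := DFunLike.congr_fun h i
  rw [specializeExponent_apply, if_pos rfl, squarefreeExponent_apply,
    if_pos (Finset.mem_insert_self i F)] at hai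
  obtain ⟨u, hu, hau⟩ : ∃ u : Option V, u.getD i = i ∧ a u ≠ 0 := by
    by_cases h0 : a none = 0
    · exact ⟨some i, rfl, by omega⟩
    · exact ⟨none, rfl, h0⟩
  refine ⟨u, hu, ?_⟩
  have hle : Finsupp.single u 1 ≤ a := Finsupp.single_le_iff.mpr (Nat.one_le_iff_ne_zero.mpr hau)
  have hsub : specializeExponent i (a - Finsupp.single u 1) = squarefreeExponent F := by
    rw [squarefreeExponent_insert hi, ← tsub_add_cancel_of_le hle, specializeExponent,
      Finsupp.mapDomain_add, Finsupp.mapDomain_single, hu] at h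
    exact add_right_cancel h
  rw [squarefreeExponent_insert (notMem_map_some hi hu),
    ← eq_squarefree_map_some_of_specializeExponent_eq hi hsub, tsub_add_cancel_of_le hle]

end Specialize

namespace SimplicialCpx

section SeparationComplex

variable {V : Type*} [DecidableEq V] {Δ : SimplicialCpx V} {i : V} {ℓ : Finset V → Option V}

/-- The complex on the variables of `S[y]` whose Stanley–Reisner ideal is generated by the `x_N`
with `i ∉ N ∉ Δ` and the `x_F ℓ(F)` with `F ∈ N_{i}(Δ)`. It is used with labels
`ℓ(F) ∈ {y, x_i}`, so that `y ↦ x_i` maps these generators to generators of `I_Δ`. -/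
def separationComplex (Δ : SimplicialCpx V) (i : V) (ℓ : Finset V → Option V) :
    SimplicialCpx (Option V) where
  carrier := {A | (∀ N ∉ Δ, i ∉ N → ¬ N.map .some ⊆ A) ∧
    ∀ F ∈ Δ.nonJoinable {i}, ¬ insert (ℓ F) (F.map .some) ⊆ A}
  lower' _ _ hBA hA := ⟨fun N hN hi h => hA.1 N hN hi (h.trans hBA),
    fun F hF h => hA.2 F hF (h.trans hBA)⟩

lemma map_some_notMem_separationComplex {N : Finset V} (hN : N ∉ Δ) (hi : i ∉ N) :
    N.map .some ∉ Δ.separationComplex i ℓ :=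
  fun h => h.1 N hN hi subset_rfl

lemma insert_map_some_notMem_separationComplex {F : Finset V} (hF : F ∈ Δ.nonJoinable {i}) :
    insert (ℓ F) (F.map .some) ∉ Δ.separationComplex i ℓ :=
  fun h => h.2 F hF subset_rfl

lemma map_some_mem_separationComplex (hi : ∀ F, (ℓ F).getD i = i) {F : Finset V}
    (hF : F ∈ Δ.nonJoinable {i}) : F.map .some ∈ Δ.separationComplex i ℓ :=
  ⟨fun _ hN _ h => hN (Δ.lower (Finset.map_subset_map.mp h) hF.1), fun G _ h =>
    notMem_map_some (mem_nonJoinable_singleton.mp hF).2.1 (hi G) (h (Finset.mem_insert_self _ _))⟩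

lemma image_getD_notMem_of_notMem_separationComplex (hi : ∀ F, (ℓ F).getD i = i)
    {A : Finset (Option V)} (hA : A ∉ Δ.separationComplex i ℓ) : A.image (·.getD i) ∉ Δ := by
  contrapose! hA
  refine ⟨fun N hN _ h => hN (Δ.lower ?_ hA), fun F hF h =>
    (mem_nonJoinable_singleton.mp hF).2.2 (Δ.lower ?_ hA)⟩
  · simpa only [image_getD_map_some] using Finset.image_subset_image (f := (·.getD i)) h
  · simpa only [Finset.image_insert, hi, image_getD_map_some] using
      Finset.image_subset_image (f := (·.getD i)) h

lemma exists_nonJoinable_of_insert_notMem {A : Finset (Option V)}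
    (hA : A ∈ Δ.separationComplex i ℓ) {u : Option V} (hu : u.getD i = i)
    (huA : insert u A ∉ Δ.separationComplex i ℓ) :
    ∃ F ∈ Δ.nonJoinable {i}, F.map .some ⊆ A ∧ ℓ F = u := by
  have subset_of_subset_insert : ∀ {F : Finset V}, i ∉ F → F.map .some ⊆ insert u A →
      F.map .some ⊆ A := fun hi h =>
    (Finset.subset_insert_iff_of_notMem (notMem_map_some hi hu)).mp h
  contrapose! huA
  refine ⟨fun N hN hi h => hA.1 N hN hi (subset_of_subset_insert hi h), fun F hF h => ?_⟩
  rw [Finset.insert_subset_iff, Finset.mem_insert] at h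
  have hFA := subset_of_subset_insert (mem_nonJoinable_singleton.mp hF).2.1 h.2
  exact hA.2 F hF (Finset.insert_subset (h.1.resolve_left (huA F hF hFA)) hFA)

lemma IsComponentLabelling.insert_mem_separationComplex (hℓ : Δ.IsComponentLabelling {i} ℓ)
    {A : Finset (Option V)} (hA : A ∈ Δ.separationComplex i ℓ) :
    insert none A ∈ Δ.separationComplex i ℓ ∨ insert (some i) A ∈ Δ.separationComplex i ℓ := by
  by_contra! h
  obtain ⟨F, hF, hFA, hFy⟩ := exists_nonJoinable_of_insert_notMem hA rfl h.1
  obtain ⟨G, hG, hGA, hGx⟩ := exists_nonJoinable_of_insert_notMem hA rfl h.2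
  obtain ⟨-, hiF, hFΔ⟩ := mem_nonJoinable_singleton.mp hF
  have hi : i ∉ F ∪ G := by simp [hiF, (mem_nonJoinable_singleton.mp hG).2.1]
  have hFG : F ∪ G ∈ Δ.nonJoinable {i} := by
    refine mem_nonJoinable_singleton.mpr ⟨by_contra fun hN => hA.1 _ hN hi ?_, hi, fun h =>
      hFΔ (Δ.lower (Finset.insert_subset_insert i Finset.subset_union_left) h)⟩
    rw [Finset.map_union]
    exact Finset.union_subset hFA hGA
  have : ℓ F = ℓ G := (hℓ hF hFG Finset.subset_union_left).trans
    (hℓ hG hFG Finset.subset_union_right).symm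
  simp [hFy, hGx] at this

variable {K : Type*} [Field K]

lemma map_specializeY_separationComplex (hi : ∀ F, (ℓ F).getD i = i) :
    ((Δ.separationComplex i ℓ).stanleyReisnerIdeal K).map (specializeY i) =
      Δ.stanleyReisnerIdeal K := by
  apply le_antisymm
  · rw [stanleyReisnerIdeal_eq_span, Ideal.map_span, Ideal.span_le]
    rintro _ ⟨_, ⟨_, ⟨A, hA, rfl⟩, rfl⟩, rfl⟩
    simp only [specializeY_monomial]
    refine monomial_mem_stanleyReisnerIdeal ?_ 1
    rw [support_specializeExponent, support_squarefreeExponent]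
    exact image_getD_notMem_of_notMem_separationComplex hi hA
  · rw [stanleyReisnerIdeal_eq_span K Δ, Ideal.span_le]
    rintro _ ⟨_, ⟨N, hN, rfl⟩, rfl⟩
    have mem_map : ∀ A ∉ Δ.separationComplex i ℓ,
        monomial (specializeExponent i (squarefreeExponent A)) (1 : K) ∈
          ((Δ.separationComplex i ℓ).stanleyReisnerIdeal K).map (specializeY i) := fun A hA => by
      rw [← specializeY_monomial]
      exact Ideal.mem_map_of_mem _ (monomial_mem_stanleyReisnerIdeal (by simpa) 1)
    by_cases hNi : N.erase i ∈ Δ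
    · obtain ⟨hiN, hF⟩ := erase_mem_nonJoinable hN hNi
      have := mem_map _ (insert_map_some_notMem_separationComplex hF)
      rwa [squarefreeExponent_insert (notMem_map_some (Finset.notMem_erase i N) (hi _)),
        specializeExponent, Finsupp.mapDomain_add, Finsupp.mapDomain_single, hi,
        ← specializeExponent, specializeExponent_squarefree_map_some,
        ← squarefreeExponent_insert (Finset.notMem_erase i N), Finset.insert_erase hiN] at this
    · have := mem_map _ (map_some_notMem_separationComplex hNi (Finset.notMem_erase i N))
      rw [specializeExponent_squarefree_map_some] at this
      exact monomial_mem_of_le (squarefreeExponent_mono (Finset.erase_subset i N)) this 1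

lemma IsComponentLabelling.isSeparation (hℓ : Δ.IsComponentLabelling {i} ℓ)
    (hi : ∀ F, (ℓ F).getD i = i) (hx : ∃ F ∈ Δ.nonJoinable {i}, ℓ F = some i)
    (hy : ∃ F ∈ Δ.nonJoinable {i}, ℓ F = none) :
    IsSeparation (Δ.stanleyReisnerIdeal K) i
      ((Δ.separationComplex i ℓ).stanleyReisnerIdeal K) where
  isMonomialIdeal := isMonomialIdeal_stanleyReisnerIdeal K _
  image_eq := by
    rw [← map_specializeY_separationComplex hi]
    ext f
    exact (Ideal.mem_map_iff_of_surjective _ specializeY_surjective).symm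
  x_dvd := by
    obtain ⟨F, hF, hFx⟩ := hx
    exact exists_isMinimalGenerator_dvd (map_some_mem_separationComplex hi hF)
      (hFx ▸ insert_map_some_notMem_separationComplex hF)
  y_dvd := by
    obtain ⟨F, hF, hFy⟩ := hy
    exact exists_isMinimalGenerator_dvd (map_some_mem_separationComplex hi hF)
      (hFy ▸ insert_map_some_notMem_separationComplex hF)
  nonZeroDivisor :=
    mk_X_sub_X_mem_nonZeroDivisors (by simp) fun _ hA => hℓ.insert_mem_separationComplex hA

end SeparationComplex

end SimplicialCpx

namespace IsSeparation

section

variable {V K : Type*} [Field K] {I : Ideal (MvPolynomial V K)} {i : V}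
  {J : Ideal (MvPolynomial (Option V) K)}

lemma monomial_specializeExponent_mem (h : IsSeparation I i J) {a : Option V →₀ ℕ}
    (ha : monomial a (1 : K) ∈ J) : monomial (specializeExponent i a) (1 : K) ∈ I := by
  rw [← specializeY_monomial]
  exact h.image_eq.subset ⟨_, ha, rfl⟩

lemma exists_specializeExponent_eq (h : IsSeparation I i J) {b : V →₀ ℕ}
    (hb : monomial b (1 : K) ∈ I) :
    ∃ a, monomial a (1 : K) ∈ J ∧ specializeExponent i a = b := by
  classical
  obtain ⟨f, hf, hfb⟩ := h.image_eq.symm.subset hb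
  rw [specializeY_eq_rename] at hfb
  obtain ⟨a, hab, ha⟩ := coeff_rename_ne_zero (·.getD i) f b (by
    rw [hfb, coeff_monomial, if_pos rfl]
    exact one_ne_zero)
  exact ⟨a, h.isMonomialIdeal.mem_iff.mp hf a (mem_support_iff.mpr ha), hab⟩

lemma monomial_mem_of_add_single_mem (h : IsSeparation I i J) {u v : Option V}
    (hu : u.getD i = i) (hv : v.getD i = i) (huv : u ≠ v) {b : Option V →₀ ℕ}
    (hbu : monomial (b + Finsupp.single u 1) (1 : K) ∈ J)
    (hbv : monomial (b + Finsupp.single v 1) (1 : K) ∈ J) : monomial b (1 : K) ∈ J := by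
  refine mk_mem_nonZeroDivisors_iff.mp h.nonZeroDivisor _ ?_
  have hX : ∀ w, (X w * monomial b 1 : MvPolynomial (Option V) K) =
      monomial (b + Finsupp.single w 1) 1 := fun w => by
    rw [X, monomial_mul, one_mul, add_comm]
  rw [sub_mul, hX, hX]
  obtain rfl | ⟨rfl, -⟩ := Option.getD_eq_iff.mp hu <;>
    obtain rfl | ⟨rfl, -⟩ := Option.getD_eq_iff.mp hv
  · exact absurd rfl huv
  · exact sub_mem hbv hbu
  · exact sub_mem hbu hbv
  · exact absurd rfl huv

end

section

variable {V K : Type*} [Field K] {Δ : SimplicialCpx V} {i : V}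
  {J : Ideal (MvPolynomial (Option V) K)}

lemma monomial_map_some_mem_iff (h : IsSeparation (Δ.stanleyReisnerIdeal K) i J)
    {F : Finset V} (hi : i ∉ F) :
    monomial (squarefreeExponent (F.map .some)) (1 : K) ∈ J ↔ F ∉ Δ := by
  refine ⟨fun hF => ?_, fun hF => ?_⟩
  · have := h.monomial_specializeExponent_mem hF
    rwa [specializeExponent_squarefree_map_some, SimplicialCpx.monomial_mem_stanleyReisnerIdeal_iff,
      support_squarefreeExponent] at this
  · obtain ⟨a, ha, haF⟩ := h.exists_specializeExponent_eq
      (SimplicialCpx.monomial_mem_stanleyReisnerIdeal (a := squarefreeExponent F) (by simpa) 1)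
    rwa [← eq_squarefree_map_some_of_specializeExponent_eq hi haF]

variable [DecidableEq V]

lemma exists_monomial_insert_mem (h : IsSeparation (Δ.stanleyReisnerIdeal K) i J)
    {F : Finset V} (hF : F ∈ Δ.nonJoinable {i}) :
    ∃ u : Option V, u.getD i = i ∧
      monomial (squarefreeExponent (insert u (F.map .some))) (1 : K) ∈ J := by
  obtain ⟨a, ha, haF⟩ := h.exists_specializeExponent_eq
    (SimplicialCpx.monomial_insert_mem_stanleyReisnerIdeal hF)
  obtain ⟨u, hu, rfl⟩ := exists_eq_squarefree_insert_of_specializeExponent_eq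
    (SimplicialCpx.mem_nonJoinable_singleton.mp hF).2.1 haF
  exact ⟨u, hu, ha⟩

lemma eq_of_monomial_insert_mem (h : IsSeparation (Δ.stanleyReisnerIdeal K) i J)
    {F : Finset V} (hF : F ∈ Δ.nonJoinable {i}) {u v : Option V} (hu : u.getD i = i)
    (hv : v.getD i = i)
    (hFu : monomial (squarefreeExponent (insert u (F.map .some))) (1 : K) ∈ J)
    (hFv : monomial (squarefreeExponent (insert v (F.map .some))) (1 : K) ∈ J) : u = v := by
  by_contra huv
  have hi := (SimplicialCpx.mem_nonJoinable_singleton.mp hF).2.1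
  rw [squarefreeExponent_insert (notMem_map_some hi hu)] at hFu
  rw [squarefreeExponent_insert (notMem_map_some hi hv)] at hFv
  exact (h.monomial_map_some_mem_iff hi).mp
    (h.monomial_mem_of_add_single_mem hu hv huv hFu hFv) hF.1

lemma exists_isComponentLabelling (h : IsSeparation (Δ.stanleyReisnerIdeal K) i J) :
    ∃ ℓ : Finset V → Option V, Δ.IsComponentLabelling {i} ℓ ∧ ∀ F ∈ Δ.nonJoinable {i},
      (ℓ F).getD i = i ∧
        monomial (squarefreeExponent (insert (ℓ F) (F.map .some))) (1 : K) ∈ J := by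
  have hex := fun F (hF : F ∈ Δ.nonJoinable {i}) => h.exists_monomial_insert_mem hF
  choose! ℓ hi hℓ using hex
  refine ⟨ℓ, fun F G hF hG hFG => ?_, fun F hF => ⟨hi F hF, hℓ F hF⟩⟩
  refine h.eq_of_monomial_insert_mem hG (hi F hF) (hi G hG)
    (monomial_mem_of_le (squarefreeExponent_mono ?_) (hℓ F hF) 1) (hℓ G hG)
  exact Finset.insert_subset_insert _ (Finset.map_subset_map.mpr hFG)

lemma monomial_mem_of_forall_insert_mem (h : IsSeparation (Δ.stanleyReisnerIdeal K) i J)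
    {u v : Option V} (hu : u.getD i = i) (hv : v.getD i = i) (huv : u ≠ v)
    (hall : ∀ F ∈ Δ.nonJoinable {i},
      monomial (squarefreeExponent (insert u (F.map .some))) (1 : K) ∈ J)
    {b : Option V →₀ ℕ} (hb : monomial (b + Finsupp.single v 1) (1 : K) ∈ J) :
    monomial b (1 : K) ∈ J := by
  set R := b.support.eraseNone.erase i
  have hiR : i ∉ R := Finset.notMem_erase _ _
  have hRb : R.map .some ⊆ b.support := fun w hw => by
    obtain ⟨j, hj, rfl⟩ := Finset.mem_map.mp hw
    exact Finset.mem_eraseNone.mp (Finset.mem_of_mem_erase hj)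
  by_cases hR : R ∈ Δ
  · have hsupp : (specializeExponent i (b + Finsupp.single v 1)).support ⊆ insert i R := by
      rw [support_specializeExponent, Finset.image_subset_iff]
      rintro w hw
      by_cases hwi : w.getD i = i
      · simp [hwi]
      obtain ⟨j, rfl⟩ : ∃ j, w = some j := by cases w <;> simp_all
      have hjv : some j ≠ v := fun h => hwi (h ▸ hv)
      have hj : some j ∈ b.support := by
        simpa [Finsupp.single_apply, hjv.symm] using hw
      exact Finset.mem_insert_of_mem (Finset.mem_erase.mpr ⟨hwi, Finset.mem_eraseNone.mpr hj⟩)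
    have hRN : R ∈ Δ.nonJoinable {i} := SimplicialCpx.mem_nonJoinable_singleton.mpr
      ⟨hR, hiR, fun hmem => SimplicialCpx.monomial_mem_stanleyReisnerIdeal_iff.mp
        (h.monomial_specializeExponent_mem hb) (Δ.lower hsupp hmem)⟩
    refine h.monomial_mem_of_add_single_mem hu hv huv
      (monomial_mem_of_le ?_ (hall R hRN) 1) hb
    rw [squarefreeExponent_insert (notMem_map_some hiR hu)]
    exact add_le_add_left (squarefreeExponent_le_iff.mpr hRb) _
  · exact monomial_mem_of_le (squarefreeExponent_le_iff.mpr hRb)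
      ((h.monomial_map_some_mem_iff hiR).mpr hR) 1

lemma not_X_dvd_of_forall_insert_mem (h : IsSeparation (Δ.stanleyReisnerIdeal K) i J)
    {u v : Option V} (hu : u.getD i = i) (hv : v.getD i = i) (huv : u ≠ v)
    (hall : ∀ F ∈ Δ.nonJoinable {i},
      monomial (squarefreeExponent (insert u (F.map .some))) (1 : K) ∈ J)
    {a : Option V →₀ ℕ} (ha : IsMinimalGenerator J a) :
    ¬ (X v : MvPolynomial (Option V) K) ∣ monomial a 1 := by
  rw [X_dvd_monomial_one_iff, not_not]
  by_contra hav
  have hle : Finsupp.single v 1 ≤ a := Finsupp.single_le_iff.mpr (Nat.one_le_iff_ne_zero.mpr hav)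
  have hmem : monomial (a - Finsupp.single v 1) (1 : K) ∈ J :=
    h.monomial_mem_of_forall_insert_mem hu hv huv hall
      (by simpa only [tsub_add_cancel_of_le hle] using ha.prop)
  have := ha.le_of_le hmem tsub_le_self v
  rw [Finsupp.tsub_apply, Finsupp.single_eq_same] at this
  omega

lemma not_preconnected (h : IsSeparation (Δ.stanleyReisnerIdeal K) i J) :
    ¬ (Δ.inclusionGraph {i}).Preconnected := by
  intro hconn
  obtain ⟨ℓ, hℓ, hmem⟩ := h.exists_isComponentLabelling
  obtain ⟨u, hu, hall⟩ : ∃ u : Option V, u.getD i = i ∧ ∀ F ∈ Δ.nonJoinable {i},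
      monomial (squarefreeExponent (insert u (F.map .some))) (1 : K) ∈ J := by
    by_cases hne : (Δ.nonJoinable {i}).Nonempty
    · refine ⟨_, (hmem _ hne.some_mem).1, fun F hF => ?_⟩
      rw [hℓ.eq_of_preconnected hconn hne.some_mem hF]
      exact (hmem F hF).2
    · exact ⟨none, rfl, fun F hF => absurd ⟨F, hF⟩ hne⟩
  obtain rfl | ⟨rfl, -⟩ := Option.getD_eq_iff.mp hu
  · obtain ⟨a, ha, hdvd⟩ := h.y_dvd
    exact h.not_X_dvd_of_forall_insert_mem hu rfl (by simp) hall ha hdvd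
  · obtain ⟨a, ha, hdvd⟩ := h.x_dvd
    exact h.not_X_dvd_of_forall_insert_mem hu rfl (by simp) hall ha hdvd

end

end IsSeparation

theorem SimplicialCpx.exists_isSeparation_iff_not_preconnected {V K : Type*} [Field K]
    [DecidableEq V] {Δ : SimplicialCpx V} {i : V} :
    (∃ J, IsSeparation (Δ.stanleyReisnerIdeal K) i J) ↔ ¬ (Δ.inclusionGraph {i}).Preconnected := by
  refine ⟨fun ⟨_, h⟩ => h.not_preconnected, fun h => ?_⟩
  obtain ⟨ℓ, hℓ, hy, hx, hyx⟩ := exists_isComponentLabelling_of_not_preconnected h none (some i)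
  exact ⟨_, hℓ.isSeparation (fun F => (hyx F).elim (· ▸ rfl) (· ▸ rfl)) hx hy⟩

theorem mainTheorem2_general (K : Type*) [Field K] {V : Type*} [DecidableEq V]
    (Δ : SimplicialCpx V) :
    List.TFAE
      [Δ.IsInseparable K,
       ∀ i : V, (Δ.inclusionGraph {i}).Preconnected,
       ∀ i : V,
        cotangentT1Component (Δ.stanleyReisnerIdeal K) (-(Pi.single i 1 : V → ℤ)) = ⊥] := by
  tfae_have 1 ↔ 2 := by
    simp only [SimplicialCpx.IsInseparable, SimplicialCpx.exists_isSeparation_iff_not_preconnected,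
      not_exists, not_not]
  tfae_have 2 ↔ 3 :=
    forall_congr' fun i => SimplicialCpx.cotangentT1Component_neg_single_eq_bot_iff.symm
  tfae_finish

theorem mainTheorem2 (K : Type*) [Field K] {n : ℕ} (Δ : SimplicialCpx (Fin n)) :
    List.TFAE
      [Δ.IsInseparable K,
       ∀ i : Fin n, (Δ.inclusionGraph {i}).Preconnected,
       ∀ i : Fin n,
        cotangentT1Component (Δ.stanleyReisnerIdeal K) (-(Pi.single i 1 : Fin n → ℤ)) = ⊥] := by
  exact mainTheorem2_general K Δ
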